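/- For $k\ge 1$ consider the integer polynomials $$g_k=\prod_{1\le i<j\le k}(x_j-x_i)(x_i+\cdots+x_j),\qquad f_k=\prod_{1\le i<j\le k}(x_j-x_i)\prod_{2\le i<j\le k}(x_i+\cdots+x_j)$$ in $x_1,\dots,x_k$. Fix an integer $d>3$, put $N_d=(d-3)(d-2)(d-1)/6$, and consider the integers $k>\min(d-1,d^2/8)$. Let $$m_{k,d}=x_1^{0}x_2^{2}x_3^{4}\cdots x_{k-d+2}^{2k-2d+2}\,x_{k-d+3}^{2k-d+1}\cdots x_k^{2k-d+1},$$ $$m'_{k,d}=x_1^{k-1}x_2^{0}x_3^{2}x_4^{4}\cdots x_{k-d+2}^{2k-2d}\,x_{k-d+3}^{2k-d-1}\cdots x_k^{2k-d-1}.$$ (If $k=d-1$, then $m_{k,d}=x_1^{0}\,x_2^{2k-d+1}\cdots x_k^{2k-d+1}$ and $m'_{k,d}=x_1^{k-1}\,x_2^{2k-d-1}\cdots x_k^{2k-d-1}$.) (a) There is a nonzero polynomial $\alpha\in\mathbb{Q}[t]$ of degree exactly $N_d$, depending only on $d$, such that for all these $k$ the coefficient of $m_{k,d}$ in $g_k$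 is $\alpha(k)$ and the coefficient of $m'_{k,d}$ in $f_k$ is $(-1)^{k-1}\alpha(k-1)$. (b) For all but at most $N_d$ of these $k$, the monomial $m_{k,d}$ has nonzero coefficient in $g_k$ and largest exponent $2k-d+1$; and for all but at most $N_d$ of these $k$, the monomial $m'_{k,d}$ has nonzero coefficient in $f_k$ and largest exponent $2k-d-1$. (c) For all but finitely many primes $p$ (depending on $d$) there is a set $E$ of at most $N_d$ integers such that for each of these $k$ not in $E$: every set of $2k-d$ distinct elements of $\mathbb{Z}_p\setminus\{0\}$ contains $k$ distinct elements $a_1,\dots,a_k$ whose partial sums $s_j=a_1+\cdots+a_j$, $1\le j\le k$, are pairwise distinct; and, in particular, if $d=\lfloor\sqrt{8k}\rfloor$, the same holds for every subset of $\mathbb{Z}_p\setminus\{0\}$ of size at least $2k-\sqrt{8k}$. -/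

import Mathlib

open Polynomial

noncomputable section

namespace PartialSums

/-- `g_k = ∏_{1 ≤ i < j ≤ k} (x_j - x_i) (x_i + ⋯ + x_j)`.
The variable `x_i` of the mathematics is `X` at the index `i - 1 : Fin k`. -/
def g (k : ℕ) : MvPolynomial (Fin k) ℤ :=
  ∏ i : Fin k, ∏ j ∈ Finset.Ioi i,
    ((MvPolynomial.X j - MvPolynomial.X i) * ∑ l ∈ Finset.Icc i j, MvPolynomial.X l)

/-- `f_k = ∏_{1 ≤ i < j ≤ k} (x_j - x_i) ∏_{2 ≤ i < j ≤ k} (x_i + ⋯ + x_j)`. -/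
def f (k : ℕ) : MvPolynomial (Fin k) ℤ :=
  (∏ i : Fin k, ∏ j ∈ Finset.Ioi i, (MvPolynomial.X j - MvPolynomial.X i)) *
    ∏ i ∈ (Finset.univ : Finset (Fin k)).filter (fun i : Fin k => 1 ≤ (i : ℕ)),
      ∏ j ∈ Finset.Ioi i, ∑ l ∈ Finset.Icc i j, MvPolynomial.X l

/-- The exponents of
`m_{k,d} = x_1^0 x_2^2 x_3^4 ⋯ x_{k-d+2}^{2k-2d+2} x_{k-d+3}^{2k-d+1} ⋯ x_k^{2k-d+1}`
(used for `k ≥ d - 1`). -/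
def gMonomial (k d : ℕ) : Fin k →₀ ℕ :=
  Finsupp.equivFunOnFinite.symm fun i =>
    if (i : ℕ) + d ≤ k + 1 then 2 * (i : ℕ) else 2 * k + 1 - d

/-- The exponents of
`x_1^{k-1} x_2^0 x_3^2 x_4^4 ⋯ x_{k-d+2}^{2k-2d} x_{k-d+3}^{2k-d-1} ⋯ x_k^{2k-d-1}`
(used for `k ≥ d - 1`). -/
def fMonomial (k d : ℕ) : Fin k →₀ ℕ :=
  Finsupp.equivFunOnFinite.symm fun i =>
    if (i : ℕ) = 0 then k - 1
    else if (i : ℕ) + d ≤ k + 1 then 2 * ((i : ℕ) - 1) else 2 * k - 1 - d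

/-- From `A` one can construct a sequence `a_1, …, a_k` of `k` distinct elements whose partial
sums `s_j = a_1 + ⋯ + a_j`, `1 ≤ j ≤ k`, are pairwise distinct. -/
def HasSequence {G : Type*} [AddCommGroup G] (A : Finset G) (k : ℕ) : Prop :=
  ∃ a : Fin k → G, Function.Injective a ∧ (∀ i, a i ∈ A) ∧
    Function.Injective fun j : Fin k => ∑ i ∈ Finset.Iic j, a i

/-- The values of `k` under consideration: `k > min (d - 1, d² / 8)`. -/
def Admissible (d k : ℕ) : Prop :=
  min ((d : ℝ) - 1) ((d : ℝ) ^ 2 / 8) < (k : ℝ)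

/-- `(d - 3) (d - 2) (d - 1) / 6`, an exact division for `d ≥ 3`. -/
def bound (d : ℕ) : ℕ := (d - 3) * (d - 2) * (d - 1) / 6

end PartialSums

end

open Polynomial

noncomputable section

/-! Put d = n + 2 and k = n + r. Extracting the exponents 0, 2, 4, … from x_1 onwards removes r
variables one at a time and leaves the coefficient of (x_1 ⋯ x_n)^(r+n-1) in (∏ s_j)^r g_n, where
the number of variables no longer depends on k (`coeff_gMonomial`). For each monomial x^β of g_n,
extracting x_n, …, x_1 gives zero or a product of binomial coefficients whose lower entries do not
depend on r: a polynomial in r (`coeff_tailPow_mul_monomial`). If nonzero, its degree is the weight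
∑ i β_i minus a constant (`natDegree_coeffPoly`). The unique heaviest monomial of g_n is ∏
x_i^(2(i-1)), with coefficient 1, so the leading term cannot cancel (`degree_coeffPolyG`). The top
power of x_1 in f_k reduces f_k to g_{k-1} (`coeff_fMonomial`).

Counting roots then bounds the exceptional k. At k = d - 1 the largest exponent for f_k is not the
stated one; this k is absorbed as a root of α(k - 1), by antisymmetry (`coeff_constExp_g`). For
primes, clear denominators, count roots modulo p, and apply the combinatorial Nullstellensatz to f_k
(`hasSequence_of_coeff_ne_zero`). -/

namespace PartialSums

/-! ### Reduction to a fixed number of variables -/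

section Reduction

/-- `g_k` multiplied by the `r`-th powers of all variables and of all partial sums. -/
def gTimesPow (k r : ℕ) : MvPolynomial (Fin k) ℤ :=
  (∏ j : Fin k, (MvPolynomial.X j * ∑ l ∈ Finset.Iic j, MvPolynomial.X l)) ^ r * g k

lemma sum_Icc_zero_succ {M : Type*} [AddCommMonoid M] {k : ℕ} (v : Fin (k + 1) → M) (j : Fin k) :
    ∑ l ∈ Finset.Icc 0 j.succ, v l = v 0 + ∑ l ∈ Finset.Iic j, v l.succ := by
  have h : Finset.Icc 0 j.succ = insert 0 ((Finset.Iic j).map (Fin.succEmb k)) := by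
    rw [Fin.map_succEmb_Iic, Finset.insert_eq, ← Finset.Icc_self]
    ext x
    refine Fin.cases ?_ (fun x => ?_) x <;> simp
  rw [h, Finset.sum_insert (by simp), Finset.sum_map]
  simp

lemma sum_Icc_succ_succ {M : Type*} [AddCommMonoid M] {k : ℕ} (v : Fin (k + 1) → M)
    (i j : Fin k) : ∑ l ∈ Finset.Icc i.succ j.succ, v l = ∑ l ∈ Finset.Icc i j, v l.succ := by
  rw [← Fin.map_succEmb_Icc, Finset.sum_map]
  simp

lemma sum_Iic_succ {M : Type*} [AddCommMonoid M] {k : ℕ} (v : Fin (k + 1) → M) (j : Fin k) :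
    ∑ l ∈ Finset.Iic j.succ, v l = v 0 + ∑ l ∈ Finset.Iic j, v l.succ := by
  rw [← sum_Icc_zero_succ]
  rfl

lemma sum_Iic_zero {M : Type*} [AddCommMonoid M] {k : ℕ} (v : Fin (k + 1) → M) :
    ∑ l ∈ Finset.Iic 0, v l = v 0 := by
  have : Finset.Iic (0 : Fin (k + 1)) = {0} := by ext x; simp
  rw [this, Finset.sum_singleton]

lemma g_succ (k : ℕ) :
    g (k + 1) = (∏ j : Fin k, (MvPolynomial.X j.succ - MvPolynomial.X 0)) *
      (∏ j : Fin k, (MvPolynomial.X 0 + ∑ l ∈ Finset.Iic j, MvPolynomial.X l.succ)) *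
      ∏ i : Fin k, ∏ j ∈ Finset.Ioi i, ((MvPolynomial.X j.succ - MvPolynomial.X i.succ) *
        ∑ l ∈ Finset.Icc i j, MvPolynomial.X l.succ) := by
  simp only [g, Fin.prod_univ_succ, Fin.prod_Ioi_zero, Fin.prod_Ioi_succ, sum_Icc_zero_succ,
    sum_Icc_succ_succ, Finset.prod_mul_distrib]
  ring

lemma finSuccEquiv_g_succ (k : ℕ) :
    MvPolynomial.finSuccEquiv ℤ k (g (k + 1)) =
      (∏ j : Fin k, (C (MvPolynomial.X j) - X)) *
      (∏ j : Fin k, (X + C (∑ l ∈ Finset.Iic j, MvPolynomial.X l))) * C (g k) := by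
  simp only [g_succ, map_mul, map_prod, map_sub, map_add, map_sum,
    MvPolynomial.finSuccEquiv_X_zero, MvPolynomial.finSuccEquiv_X_succ]
  simp only [g, map_mul, map_prod, map_sub, map_sum]

lemma finSuccEquiv_gTimesPow (k r : ℕ) :
    MvPolynomial.finSuccEquiv ℤ k (gTimesPow (k + 1) r) =
      (∏ j : Fin k, (C (MvPolynomial.X j) * (X + C (∑ l ∈ Finset.Iic j, MvPolynomial.X l)))) ^ r *
      ((∏ j : Fin k, (C (MvPolynomial.X j) - X)) *
      (∏ j : Fin k, (X + C (∑ l ∈ Finset.Iic j, MvPolynomial.X l))) * C (g k)) * X ^ (2 * r) := by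
  rw [gTimesPow, map_mul, finSuccEquiv_g_succ]
  simp only [Fin.prod_univ_succ, sum_Iic_zero, sum_Iic_succ, map_pow, map_mul, map_prod, map_add,
    map_sum, MvPolynomial.finSuccEquiv_X_zero, MvPolynomial.finSuccEquiv_X_succ, pow_mul]
  ring

/-- The first variable and the first partial sum are both x_1, so x_1^(2r) splits off and the
cofactor is evaluated at x_1 = 0. There the factors of g_{k+1} involving x_1 become one more copy of
∏ x_j s_j. -/
lemma coeff_cons_gTimesPow (k r : ℕ) (m : Fin k →₀ ℕ) :
    (gTimesPow (k + 1) r).coeff (m.cons (2 * r)) = (gTimesPow k (r + 1)).coeff m := by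
  rw [← MvPolynomial.finSuccEquiv_coeff_coeff, finSuccEquiv_gTimesPow, Polynomial.coeff_mul_X_pow',
    if_pos le_rfl, Nat.sub_self, Polynomial.coeff_zero_eq_eval_zero]
  congr 1
  simp only [eval_mul, eval_pow, eval_prod, eval_C, eval_add, eval_X, zero_add, eval_sub, sub_zero,
    gTimesPow, Finset.prod_mul_distrib]
  ring

/-- The exponents `2 i, 2 i + 2, …, 2 i + 2 r - 2` followed by `n` equal exponents. -/
def stairs (n r i : ℕ) : Fin (n + r) →₀ ℕ :=
  Finsupp.equivFunOnFinite.symm fun j =>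
    if (j : ℕ) < r then 2 * (i + j) else 2 * (i + r) + n - 1

lemma stairs_succ (n r i : ℕ) : stairs n (r + 1) i = (stairs n r (i + 1)).cons (2 * i) := by
  ext j
  refine Fin.cases ?_ (fun j => ?_) j
  · rw [Finsupp.cons_zero]
    simp [stairs]
  · rw [Finsupp.cons_succ]
    simp only [stairs, Finsupp.coe_equivFunOnFinite_symm, Fin.val_succ]
    split_ifs <;> omega

lemma coeff_stairs (n r i : ℕ) :
    (gTimesPow (n + r) i).coeff (stairs n r i) =
      (gTimesPow n (i + r)).coeff (Finsupp.equivFunOnFinite.symm fun _ => 2 * (i + r) + n - 1) := by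
  induction r generalizing i with
  | zero => simp [stairs]
  | succ r ih =>
    rw [stairs_succ]
    refine (coeff_cons_gTimesPow _ _ _).trans ?_
    rw [ih, show i + 1 + r = i + (r + 1) by ring]

lemma gMonomial_eq_stairs (n r : ℕ) (hn : 1 ≤ n) : gMonomial (n + r) (n + 2) = stairs n r 0 := by
  ext j
  simp only [gMonomial, stairs, Finsupp.coe_equivFunOnFinite_symm]
  split_ifs <;> omega

lemma prod_X_eq_monomial (n : ℕ) :
    (∏ j : Fin n, (MvPolynomial.X j : MvPolynomial (Fin n) ℤ)) =
      MvPolynomial.monomial (Finsupp.equivFunOnFinite.symm fun _ => 1) 1 := by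
  rw [MvPolynomial.monomial_eq, Finsupp.prod_fintype _ _ (by simp)]
  simp

lemma coeff_gMonomial (n r : ℕ) (hn : 1 ≤ n) :
    (g (n + r)).coeff (gMonomial (n + r) (n + 2)) =
      ((∏ j : Fin n, ∑ l ∈ Finset.Iic j, MvPolynomial.X l) ^ r * g n).coeff
        (Finsupp.equivFunOnFinite.symm fun _ => r + (n - 1)) := by
  have h0 : g (n + r) = gTimesPow (n + r) 0 := by simp [gTimesPow]
  rw [gMonomial_eq_stairs n r hn, h0, coeff_stairs, zero_add, gTimesPow, Finset.prod_mul_distrib,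
    prod_X_eq_monomial, mul_pow, MvPolynomial.monomial_pow, mul_assoc, one_pow]
  have h1 : (Finsupp.equivFunOnFinite.symm fun _ => 2 * r + n - 1 : Fin n →₀ ℕ) =
      r • (Finsupp.equivFunOnFinite.symm fun _ => 1) +
        Finsupp.equivFunOnFinite.symm fun _ => r + (n - 1) := by
    ext j
    simp
    omega
  rw [h1, MvPolynomial.coeff_monomial_mul, one_mul]

lemma f_succ (k : ℕ) :
    f (k + 1) = (∏ j : Fin k, (MvPolynomial.X j.succ - MvPolynomial.X 0)) *
      ∏ i : Fin k, ∏ j ∈ Finset.Ioi i, ((MvPolynomial.X j.succ - MvPolynomial.X i.succ) *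
        ∑ l ∈ Finset.Icc i j, MvPolynomial.X l.succ) := by
  have h : (Finset.univ : Finset (Fin (k + 1))).filter (fun i : Fin (k + 1) => 1 ≤ (i : ℕ)) =
      Finset.univ.map (Fin.succEmb k) := by
    ext i
    refine Fin.cases ?_ (fun j => ?_) i <;> simp
  rw [f, h, Finset.prod_map]
  simp only [Fin.prod_univ_succ, Fin.prod_Ioi_zero, Fin.prod_Ioi_succ, Fin.coe_succEmb,
    sum_Icc_succ_succ, Finset.prod_mul_distrib]
  ring

lemma finSuccEquiv_f_succ (k : ℕ) :
    MvPolynomial.finSuccEquiv ℤ k (f (k + 1)) =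
      (∏ j : Fin k, (C (MvPolynomial.X j) - X)) * C (g k) := by
  simp only [f_succ, map_mul, map_prod, map_sub, map_sum,
    MvPolynomial.finSuccEquiv_X_zero, MvPolynomial.finSuccEquiv_X_succ]
  simp only [g, map_mul, map_prod, map_sub, map_sum]

/-- The omitted sums are exactly those containing x_1, so x_1 occurs only in ∏ (x_j - x_1), whose
leading coefficient in x_1 is (-1)^k. -/
lemma coeff_cons_f (k : ℕ) (m : Fin k →₀ ℕ) :
    (f (k + 1)).coeff (m.cons k) = (-1) ^ k * (g k).coeff m := by
  have h : (∏ j : Fin k, (C (MvPolynomial.X j) - X : (MvPolynomial (Fin k) ℤ)[X])) =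
      C ((-1) ^ k) * ∏ j : Fin k, (X - C (MvPolynomial.X j)) := by
    rw [show (C ((-1) ^ k) : (MvPolynomial (Fin k) ℤ)[X]) = ∏ _j : Fin k, (-1) by simp,
      ← Finset.prod_mul_distrib]
    exact Finset.prod_congr rfl fun j _ => by ring
  have h' : (∏ j : Fin k, (X - C (MvPolynomial.X j : MvPolynomial (Fin k) ℤ))).coeff k = 1 := by
    have := monic_prod_X_sub_C (fun j : Fin k => (MvPolynomial.X j : MvPolynomial (Fin k) ℤ))
      Finset.univ
    rw [Monic, leadingCoeff, natDegree_finsetProd_X_sub_C_eq_card, Finset.card_univ,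
      Fintype.card_fin] at this
    exact this
  rw [← MvPolynomial.finSuccEquiv_coeff_coeff, finSuccEquiv_f_succ, h, coeff_mul_C, coeff_C_mul, h',
    mul_one]
  rw [show ((-1) ^ k : MvPolynomial (Fin k) ℤ) = MvPolynomial.C ((-1) ^ k) by simp,
    MvPolynomial.coeff_C_mul]

lemma coeff_fMonomial (k d : ℕ) :
    (f (k + 1)).coeff (fMonomial (k + 1) d) = (-1) ^ k * (g k).coeff (gMonomial k d) := by
  rw [← coeff_cons_f]
  congr 1
  ext j
  refine Fin.cases ?_ (fun j => ?_) j
  · rw [Finsupp.cons_zero]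
    simp [fMonomial]
  · rw [Finsupp.cons_succ]
    simp only [fMonomial, gMonomial, Finsupp.coe_equivFunOnFinite_symm, Fin.val_succ]
    rw [if_neg (Nat.succ_ne_zero _)]
    split_ifs <;> omega

end Reduction

/-! ### Coefficients of powers of tail sums, as polynomials in the power -/

section TailPowers

/-- The sum of all variables to the power `a`, times the `r`-th powers of all tail sums. -/
def tailPow (n a r : ℕ) : MvPolynomial (Fin n) ℤ :=
  (∑ l, MvPolynomial.X l) ^ a * (∏ j : Fin n, ∑ l ∈ Finset.Ici j, MvPolynomial.X l) ^ r

/-- The polynomial whose value at `x` is the binomial coefficient `(x + a).choose m`. -/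
def shiftedChoose (a m : ℕ) : ℚ[X] :=
  C ((m.factorial : ℚ)⁻¹) * (descPochhammer ℚ m).comp (X + C (a : ℚ))

lemma eval_shiftedChoose (a m r : ℕ) :
    (shiftedChoose a m).eval (r : ℚ) = ((a + r).choose m : ℚ) := by
  rw [shiftedChoose, eval_mul, eval_C, eval_comp, eval_add, eval_X, eval_C,
    Nat.cast_choose_eq_descPochhammer_div, Nat.cast_add, add_comm (r : ℚ), div_eq_inv_mul]

lemma shiftedChoose_ne_zero (a m : ℕ) : shiftedChoose a m ≠ 0 := by
  intro h
  have := eval_shiftedChoose a m m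
  rw [h, eval_zero] at this
  have h2 : 0 < (a + m).choose m := Nat.choose_pos (by omega)
  exact h2.ne (by exact_mod_cast this)

lemma natDegree_shiftedChoose (a m : ℕ) : (shiftedChoose a m).natDegree = m := by
  rw [shiftedChoose, natDegree_C_mul (by positivity), natDegree_comp, natDegree_X_add_C, mul_one,
    descPochhammer_natDegree]

/-- The polynomial in `r` giving the coefficient of `(x_1 ⋯ x_n) ^ (r + N)` in
`tailPow n a r * x ^ β`. -/
def coeffPoly (N : ℕ) : (n a : ℕ) → (Fin n →₀ ℕ) → ℚ[X]
  | 0, a, _ => if a = 0 then 1 else 0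
  | n + 1, a, β => if N ≤ a + β 0 then
      shiftedChoose a (a + β 0 - N) * coeffPoly N n (a + β 0 - N) β.tail else 0

/-- The exponent vector with all entries equal to `c`. -/
abbrev constExp (n c : ℕ) : Fin n →₀ ℕ := Finsupp.equivFunOnFinite.symm fun _ => c

lemma constExp_succ (n c : ℕ) : constExp (n + 1) c = (constExp n c).cons c := by
  ext j
  refine Fin.cases ?_ (fun j => ?_) j <;> simp

lemma finSuccEquiv_monomial (n : ℕ) (β : Fin (n + 1) →₀ ℕ) :
    MvPolynomial.finSuccEquiv ℤ n (MvPolynomial.monomial β 1) =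
      C (MvPolynomial.monomial β.tail 1) * X ^ β 0 := by
  rw [MvPolynomial.monomial_eq, MvPolynomial.monomial_eq, Finsupp.prod_fintype _ _ (by simp),
    Finsupp.prod_fintype _ _ (by simp), Fin.prod_univ_succ]
  simp only [map_mul, map_prod, map_pow, MvPolynomial.finSuccEquiv_X_zero, map_one,
    MvPolynomial.finSuccEquiv_X_succ, Finsupp.tail_apply, one_mul]
  ring

lemma finSuccEquiv_tailPow (n a r : ℕ) :
    MvPolynomial.finSuccEquiv ℤ n (tailPow (n + 1) a r) =
      (X + C (∑ l, MvPolynomial.X l)) ^ (a + r) *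
        C ((∏ j : Fin n, ∑ l ∈ Finset.Ici j, MvPolynomial.X l) ^ r) := by
  have h0 : Finset.Ici (0 : Fin (n + 1)) = Finset.univ := by ext; simp
  simp only [tailPow, Fin.prod_univ_succ, h0, Fin.sum_univ_succ, ← Fin.map_succEmb_Ici,
    Finset.sum_map, Fin.coe_succEmb, map_mul, map_pow, map_add, map_sum, map_prod,
    MvPolynomial.finSuccEquiv_X_zero, MvPolynomial.finSuccEquiv_X_succ, pow_add, mul_pow]
  ring

/-- The first variable occurs only in the total sum, raised to a + r, and in x^β. The binomial
theorem fixes its exponent and leaves the sum of the other variables with excess power a + β_0 - N,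
which does not involve r; this is the recursion of `coeffPoly`. -/
lemma coeff_tailPow_mul_monomial (N n a r : ℕ) (β : Fin n →₀ ℕ) :
    (((tailPow n a r * MvPolynomial.monomial β 1).coeff (constExp n (r + N)) : ℤ) : ℚ) =
      (coeffPoly N n a β).eval (r : ℚ) := by
  induction n generalizing a with
  | zero =>
    have h1 : β = 0 := Subsingleton.elim _ _
    have h2 : constExp 0 (r + N) = 0 := Subsingleton.elim _ _
    rw [h1, h2, coeffPoly]
    rcases Nat.eq_zero_or_pos a with rfl | ha
    · simp [tailPow]
    · simp [tailPow, ha.ne']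
  | succ n ih =>
    have key : (tailPow (n + 1) a r * MvPolynomial.monomial β 1).coeff (constExp (n + 1) (r + N)) =
        if β 0 ≤ r + N then ((a + r).choose (r + N - β 0) : ℤ) *
          (tailPow n (a + r - (r + N - β 0)) r * MvPolynomial.monomial β.tail 1).coeff
            (constExp n (r + N)) else 0 := by
      rw [constExp_succ, ← MvPolynomial.finSuccEquiv_coeff_coeff, map_mul, finSuccEquiv_monomial,
        finSuccEquiv_tailPow, ← mul_assoc, Polynomial.coeff_mul_X_pow']
      split_ifs with h
      · rw [coeff_mul_C, coeff_mul_C, coeff_X_add_C_pow, tailPow,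
          ← MvPolynomial.coeff_C_mul]
        congr 1
        simp only [map_natCast]
        ring
      · simp
    rw [key, coeffPoly]
    by_cases h1 : N ≤ a + β 0
    · rw [if_pos h1, eval_mul, ← ih, eval_shiftedChoose]
      by_cases h2 : β 0 ≤ r + N
      · rw [if_pos h2]
        by_cases h3 : r + N - β 0 ≤ a + r
        · rw [← Nat.choose_symm h3, show a + r - (r + N - β 0) = a + β 0 - N by omega]
          push_cast
          rfl
        · omega
      -- Here x_0 already has too large an exponent; the polynomial agrees, since a + β_0 - N
      -- exceeds a + r.
      · rw [if_neg h2, Nat.choose_eq_zero_of_lt (by omega)]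
        simp
    · rw [if_neg h1, eval_zero]
      split_ifs with h2
      · rw [Nat.choose_eq_zero_of_lt (by omega)]
        simp
      · simp

/-- Each binomial contributes its lower entry to the degree. The lower entries are accumulated sums
of β_i - N, so β_i is counted n - i times. The identity is kept additive to avoid truncated
subtraction. -/
lemma natDegree_coeffPoly (N n a : ℕ) (β : Fin n →₀ ℕ) (h : coeffPoly N n a β ≠ 0) :
    (coeffPoly N n a β).natDegree + N * ∑ i : Fin n, (n - (i : ℕ)) =
      a * n + ∑ i : Fin n, (n - (i : ℕ)) * β i := by
  induction n generalizing a with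
  | zero =>
    rw [coeffPoly] at h ⊢
    split_ifs at h ⊢ <;> simp_all
  | succ n ih =>
    rw [coeffPoly] at h ⊢
    split_ifs at h ⊢ with h1
    · have h2 := right_ne_zero_of_mul h
      have h3 := ih _ _ h2
      rw [natDegree_mul (shiftedChoose_ne_zero _ _) h2, natDegree_shiftedChoose]
      simp only [Fin.sum_univ_succ, Fin.val_zero, Fin.val_succ, Nat.add_sub_add_right,
        Finsupp.tail_apply, Nat.sub_zero] at h3 ⊢
      obtain ⟨c, hc⟩ := Nat.exists_eq_add_of_le h1
      rw [hc, Nat.add_sub_cancel_left] at h3 ⊢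
      nlinarith
    · exact absurd rfl h

/-- The parameter j counts the variables already extracted; the excess power is then j times the
number remaining, so the recursion never reaches its zero branches. -/
lemma coeffPoly_top_ne_zero (n j : ℕ) (β : Fin n →₀ ℕ)
    (hβ : ∀ i : Fin n, β i = 2 * (n - 1 - (i : ℕ))) :
    coeffPoly (n + j - 1) n (j * n) β ≠ 0 := by
  induction n generalizing j with
  | zero => simp [coeffPoly]
  | succ n ih =>
    have h0 : β 0 = 2 * n := by simp [hβ]
    have h1 : n + 1 + j - 1 ≤ j * (n + 1) + β 0 := by
      rw [h0]
      have : j ≤ j * (n + 1) := Nat.le_mul_of_pos_right _ (by omega)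
      omega
    have h2 : j * (n + 1) + β 0 - (n + 1 + j - 1) = (j + 1) * n := by
      rw [h0]
      have : j * (n + 1) = j * n + j := by ring
      have : (j + 1) * n = j * n + n := by ring
      omega
    rw [coeffPoly, if_pos h1, h2]
    refine mul_ne_zero (shiftedChoose_ne_zero _ _) ?_
    rw [show n + 1 + j - 1 = n + (j + 1) - 1 by omega]
    refine ih _ _ fun i => ?_
    rw [Finsupp.tail_apply, hβ, Fin.val_succ]
    omega

end TailPowers

/-! ### The unique heaviest monomial of g_n -/

section TopMonomial

variable {σ : Type*} {w : (σ →₀ ℕ) →+ ℕ}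

/-- All monomials of `p - x ^ m` have smaller weight than `x ^ m`. -/
def IsTop (w : (σ →₀ ℕ) →+ ℕ) (p : MvPolynomial σ ℤ) (m : σ →₀ ℕ) : Prop :=
  ∀ β ∈ (p - MvPolynomial.monomial m 1).support, w β < w m

lemma IsTop.one : IsTop w 1 0 := by
  intro β hβ
  rw [show (1 : MvPolynomial σ ℤ) - MvPolynomial.monomial 0 1 = 0 from sub_self _] at hβ
  simp at hβ

lemma IsTop.mul {p q : MvPolynomial σ ℤ} {m l : σ →₀ ℕ} (hp : IsTop w p m) (hq : IsTop w q l) :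
    IsTop w (p * q) (m + l) := by
  classical
  intro β hβ
  have h : p * q - MvPolynomial.monomial (m + l) 1 =
      (p - MvPolynomial.monomial m 1) * (q - MvPolynomial.monomial l 1) +
      ((p - MvPolynomial.monomial m 1) * MvPolynomial.monomial l 1 +
        MvPolynomial.monomial m 1 * (q - MvPolynomial.monomial l 1)) := by
    rw [show MvPolynomial.monomial (m + l) (1 : ℤ) =
      MvPolynomial.monomial m 1 * MvPolynomial.monomial l 1 by
        rw [MvPolynomial.monomial_mul, one_mul]]
    ring
  rw [h] at hβ
  have hmon : ∀ e : σ →₀ ℕ, ∀ x ∈ (MvPolynomial.monomial e (1 : ℤ)).support, x = e := by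
    intro e x hx
    simpa using MvPolynomial.support_monomial_subset hx
  rw [map_add]
  rcases Finset.mem_union.1 (MvPolynomial.support_add hβ) with h | h
  · obtain ⟨x, hx, y, hy, rfl⟩ := Finset.mem_add.1 (MvPolynomial.support_mul _ _ h)
    rw [map_add]
    exact add_lt_add (hp x hx) (hq y hy)
  · rcases Finset.mem_union.1 (MvPolynomial.support_add h) with h | h
    · obtain ⟨x, hx, y, hy, rfl⟩ := Finset.mem_add.1 (MvPolynomial.support_mul _ _ h)
      rw [map_add, hmon _ _ hy]
      exact Nat.add_lt_add_right (hp x hx) _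
    · obtain ⟨x, hx, y, hy, rfl⟩ := Finset.mem_add.1 (MvPolynomial.support_mul _ _ h)
      rw [map_add, hmon _ _ hx]
      exact Nat.add_lt_add_left (hq y hy) _

lemma IsTop.prod {ι : Type*} (s : Finset ι) (p : ι → MvPolynomial σ ℤ) (m : ι → σ →₀ ℕ)
    (h : ∀ i ∈ s, IsTop w (p i) (m i)) : IsTop w (∏ i ∈ s, p i) (∑ i ∈ s, m i) := by
  classical
  induction s using Finset.induction_on with
  | empty => simpa using IsTop.one
  | insert a s ha ih =>
    rw [Finset.prod_insert ha, Finset.sum_insert ha]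
    exact (h _ (Finset.mem_insert_self _ _)).mul
      (ih fun i hi => h i (Finset.mem_insert_of_mem hi))

lemma IsTop.coeff_eq_one {p : MvPolynomial σ ℤ} {m : σ →₀ ℕ} (h : IsTop w p m) :
    p.coeff m = 1 := by
  classical
  have h1 : m ∉ (p - MvPolynomial.monomial m 1).support := fun hm => (h m hm).false
  rw [MvPolynomial.notMem_support_iff, MvPolynomial.coeff_sub, MvPolynomial.coeff_monomial,
    if_pos rfl] at h1
  omega

lemma IsTop.lt {p : MvPolynomial σ ℤ} {m β : σ →₀ ℕ} (h : IsTop w p m) (hβ : β ∈ p.support)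
    (hne : β ≠ m) : w β < w m := by
  classical
  refine h β ?_
  rw [MvPolynomial.mem_support_iff, MvPolynomial.coeff_sub, MvPolynomial.coeff_monomial,
    if_neg hne.symm, sub_zero]
  exact MvPolynomial.mem_support_iff.1 hβ

lemma isTop_sum_X (s : Finset σ) (c : σ → ℤ) (j : σ) (hj : j ∈ s) (hc : c j = 1)
    (h : ∀ i ∈ s, i ≠ j → w (Finsupp.single i 1) < w (Finsupp.single j 1)) :
    IsTop w (∑ i ∈ s, MvPolynomial.C (c i) * MvPolynomial.X i) (Finsupp.single j 1) := by
  classical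
  intro β hβ
  rw [← Finset.add_sum_erase _ _ hj, hc, map_one, one_mul, ← MvPolynomial.X, add_sub_cancel_left]
    at hβ
  obtain ⟨i, hi, hiβ⟩ := Finset.mem_biUnion.1 (MvPolynomial.support_sum hβ)
  rw [MvPolynomial.C_mul_X_eq_monomial] at hiβ
  have := MvPolynomial.support_monomial_subset hiβ
  rw [Finset.mem_singleton] at this
  rw [this]
  exact h i (Finset.mem_of_mem_erase hi) (Finset.ne_of_mem_erase hi)

/-- The weight in which the variable at the index `i : Fin n` has weight `i + 1`. -/
def indexWeight (n : ℕ) : (Fin n →₀ ℕ) →+ ℕ where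
  toFun β := ∑ i : Fin n, ((i : ℕ) + 1) * β i
  map_zero' := by simp
  map_add' x y := by simp [mul_add, Finset.sum_add_distrib]

lemma indexWeight_single (n : ℕ) (i : Fin n) : indexWeight n (Finsupp.single i 1) = i + 1 := by
  simp [indexWeight, Finsupp.single_apply]

/-- The exponents `0, 2, 4, …` of the top monomial of `g_n`. -/
def topExp (n : ℕ) : Fin n →₀ ℕ := Finsupp.equivFunOnFinite.symm fun i => 2 * (i : ℕ)

/-- In both factors attached to i < j the heaviest variable is x_j, with coefficient 1, and tops
multiply. -/
lemma isTop_g (n : ℕ) : IsTop (indexWeight n) (g n) (topExp n) := by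
  have h : topExp n = ∑ i : Fin n, ∑ j ∈ Finset.Ioi i,
      (Finsupp.single j 1 + Finsupp.single j 1) := by
    ext l
    simp only [Finsupp.finsetSum_apply, Finsupp.add_apply, Finsupp.single_apply, topExp,
      Finsupp.coe_equivFunOnFinite_symm]
    simp only [← two_mul, ← Finset.mul_sum, Finset.sum_ite_eq', Finset.mem_Ioi]
    simp [Finset.sum_boole, Finset.filter_gt_eq_Iio]
  rw [h, g]
  refine IsTop.prod _ _ _ fun i _ => IsTop.prod _ _ _ fun j hj => IsTop.mul ?_ ?_
  · have hij := Finset.mem_Ioi.1 hj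
    have := isTop_sum_X (w := indexWeight n) {i, j} (fun l => if l = j then 1 else -1) j (by simp)
      (by simp) (by
        intro l hl hlj
        rw [Finset.mem_insert, Finset.mem_singleton, or_iff_left hlj] at hl
        rw [indexWeight_single, indexWeight_single, hl]
        simpa using hij)
    rw [Finset.sum_pair hij.ne, if_neg hij.ne, if_pos rfl] at this
    convert this using 1
    simp
    ring
  · have hij := Finset.mem_Ioi.1 hj
    have := isTop_sum_X (w := indexWeight n) (Finset.Icc i j) (fun l => 1) j
      (by simp [hij.le]) rfl (by
        intro l hl hlj
        rw [indexWeight_single, indexWeight_single]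
        have := lt_of_le_of_ne (Finset.mem_Icc.1 hl).2 hlj
        simpa using this)
    simpa using this

end TopMonomial

/-! ### The coefficient polynomial and its degree -/

section LeadPolynomial

lemma constExp_mapDomain {n : ℕ} (e : Equiv.Perm (Fin n)) (c : ℕ) :
    (constExp n c).mapDomain e = constExp n c := by
  ext i
  rw [Finsupp.mapDomain_equiv_apply]
  rfl

/-- Reversal turns partial sums into tail sums and fixes constant exponent vectors, so the tail
computation applies. -/
lemma rename_rev_prod (n r : ℕ) :
    MvPolynomial.rename (Fin.revPerm : Equiv.Perm (Fin n))
      ((∏ j : Fin n, ∑ l ∈ Finset.Iic j, (MvPolynomial.X l : MvPolynomial (Fin n) ℤ)) ^ r) =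
      tailPow n 0 r := by
  rw [tailPow, pow_zero, one_mul, map_pow, map_prod]
  congr 1
  refine Fintype.prod_equiv Fin.revPerm _ _ fun j => ?_
  rw [map_sum]
  refine Finset.sum_equiv Fin.revPerm (fun l => ?_) fun l _ => ?_
  · simp
  · simp

/-- The polynomial whose value at `r` is the coefficient of the monomial `gMonomial (n + r) (n + 2)`
in `g (n + r)`. -/
def coeffPolyG (n : ℕ) : ℚ[X] :=
  ∑ β ∈ (g n).support, C (((g n).coeff β : ℤ) : ℚ) * coeffPoly (n - 1) n 0 (β.mapDomain Fin.revPerm)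

lemma coeff_gMonomial_eq_eval (n r : ℕ) (hn : 1 ≤ n) :
    (((g (n + r)).coeff (gMonomial (n + r) (n + 2)) : ℤ) : ℚ) = (coeffPolyG n).eval (r : ℚ) := by
  rw [coeff_gMonomial n r hn, coeffPolyG, eval_finsetSum]
  conv_lhs => rw [(g n).as_sum, Finset.mul_sum, MvPolynomial.coeff_sum, Int.cast_sum]
  refine Finset.sum_congr rfl fun β _ => ?_
  rw [eval_mul, eval_C, ← coeff_tailPow_mul_monomial, ← Int.cast_mul]
  congr 1
  rw [← MvPolynomial.coeff_rename_mapDomain Fin.revPerm Fin.revPerm.injective,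
    constExp_mapDomain, map_mul, rename_rev_prod, MvPolynomial.rename_monomial,
    ← MvPolynomial.coeff_C_mul, mul_left_comm, MvPolynomial.C_mul_monomial, mul_one]

lemma sum_rev_weight (n : ℕ) (β : Fin n →₀ ℕ) :
    ∑ i : Fin n, (n - (i : ℕ)) * (β.mapDomain Fin.revPerm) i = indexWeight n β := by
  simp only [indexWeight, AddMonoidHom.coe_mk, ZeroHom.coe_mk]
  refine (Fintype.sum_equiv Fin.revPerm _ _ fun i => ?_).symm
  rw [Finsupp.mapDomain_equiv_apply]
  have := i.isLt
  simp only [Fin.revPerm_apply, Fin.revPerm_symm, Fin.rev_rev, Fin.val_rev]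
  congr 1
  omega

lemma natDegree_coeffPoly_rev {n N : ℕ} {β : Fin n →₀ ℕ}
    (h : coeffPoly N n 0 (β.mapDomain Fin.revPerm) ≠ 0) :
    (coeffPoly N n 0 (β.mapDomain Fin.revPerm)).natDegree + N * ∑ i : Fin n, (n - (i : ℕ)) =
      indexWeight n β := by
  rw [natDegree_coeffPoly _ _ _ _ h, sum_rev_weight, zero_mul, zero_add]

lemma coeffPoly_topExp_ne_zero (n : ℕ) :
    coeffPoly (n - 1) n 0 ((topExp n).mapDomain Fin.revPerm) ≠ 0 := by
  have := coeffPoly_top_ne_zero n 0 ((topExp n).mapDomain Fin.revPerm) fun i => by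
    rw [Finsupp.mapDomain_equiv_apply]
    have := i.isLt
    simp only [topExp, Finsupp.coe_equivFunOnFinite_symm, Fin.revPerm_symm, Fin.revPerm_apply,
      Fin.val_rev]
    omega
  rwa [zero_mul, add_zero] at this

lemma degree_coeffPolyG (n : ℕ) :
    (coeffPolyG n).degree =
      (coeffPoly (n - 1) n 0 ((topExp n).mapDomain Fin.revPerm)).degree := by
  have hT := coeffPoly_topExp_ne_zero n
  have htop : topExp n ∈ (g n).support := by
    rw [MvPolynomial.mem_support_iff, (isTop_g n).coeff_eq_one]
    exact one_ne_zero
  rw [coeffPolyG, ← Finset.add_sum_erase _ _ htop, (isTop_g n).coeff_eq_one, Int.cast_one, C_1,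
    one_mul]
  refine degree_add_eq_left_of_degree_lt ?_
  rw [degree_eq_natDegree hT, ← mem_degreeLT]
  refine Submodule.sum_mem _ fun β hβ => ?_
  rw [C_mul']
  refine Submodule.smul_mem _ _ ?_
  rw [mem_degreeLT]
  by_cases h0 : coeffPoly (n - 1) n 0 (β.mapDomain Fin.revPerm) = 0
  · rw [h0, degree_zero]
    exact WithBot.bot_lt_coe _
  · rw [degree_eq_natDegree h0, Nat.cast_lt]
    have h1 := natDegree_coeffPoly_rev h0
    have h2 := natDegree_coeffPoly_rev hT
    have h3 := (isTop_g n).lt (Finset.mem_of_mem_erase hβ) (Finset.ne_of_mem_erase hβ)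
    omega

lemma coeffPolyG_ne_zero (n : ℕ) : coeffPolyG n ≠ 0 := by
  rw [← degree_ne_bot, degree_coeffPolyG, degree_ne_bot]
  exact coeffPoly_topExp_ne_zero n

lemma natDegree_coeffPolyG (n : ℕ) :
    (coeffPolyG (n + 1)).natDegree = n * (n + 1) * (n + 2) / 6 := by
  rw [natDegree_eq_of_degree_eq (degree_coeffPolyG (n + 1))]
  have h := natDegree_coeffPoly_rev (coeffPoly_topExp_ne_zero (n + 1))
  have h1 : ∀ m : ℕ, 2 * ∑ i : Fin m, (m - (i : ℕ)) = m * (m + 1) := by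
    intro m
    induction m with
    | zero => simp
    | succ m ih =>
      rw [Fin.sum_univ_succ]
      simp only [Fin.val_succ, Nat.add_sub_add_right, Fin.val_zero, Nat.sub_zero, mul_add, ih]
      ring
  have h2 : ∀ m : ℕ, 3 * indexWeight (m + 1) (topExp (m + 1)) = 2 * (m * (m + 1) * (m + 2)) := by
    intro m
    simp only [indexWeight, topExp, AddMonoidHom.coe_mk, ZeroHom.coe_mk,
      Finsupp.coe_equivFunOnFinite_symm]
    rw [Fin.sum_univ_eq_sum_range (fun i => (i + 1) * (2 * i))]
    induction m with
    | zero => simp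
    | succ m ih =>
      rw [Finset.sum_range_succ, mul_add, ih]
      ring
  have h1' := h1 (n + 1)
  have h2' := h2 n
  rw [Nat.add_sub_cancel] at h ⊢
  symm
  apply Nat.div_eq_of_eq_mul_right (by norm_num)
  nlinarith

end LeadPolynomial

/-! ### Vanishing of the coefficient at r = 0 -/

section Antisymmetry

lemma sum_range_card_le_sum (s : Finset ℕ) : ∑ i ∈ Finset.range s.card, i ≤ ∑ i ∈ s, i := by
  induction s using Finset.induction_on_max with
  | empty => simp
  | insert a s ha ih =>
    have has : a ∉ s := fun h => (ha a h).false
    have hs : s.card ≤ a := by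
      simpa using Finset.card_le_card (fun x hx => Finset.mem_range.2 (ha x hx) : s ⊆ Finset.range a)
    rw [Finset.card_insert_of_notMem has, Finset.sum_insert has, Finset.sum_range_succ]
    omega

/-- Distinct exponents would sum to at least 0 + 1 + ⋯ + (n - 1). -/
lemma exists_eq_of_degree_lt {n : ℕ} (β : Fin n →₀ ℕ)
    (h : β.degree < ∑ i ∈ Finset.range n, i) : ∃ a b : Fin n, a ≠ b ∧ β a = β b := by
  by_contra! hne
  have hinj : Function.Injective β := fun a b hab => by
    by_contra h'
    exact hne a b h' hab
  have h1 := sum_range_card_le_sum (Finset.univ.image β)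
  rw [Finset.card_image_of_injective _ hinj, Finset.sum_image hinj.injOn, Finset.card_univ,
    Fintype.card_fin] at h1
  rw [Finsupp.degree_eq_sum] at h
  omega

lemma rename_vandermonde {n : ℕ} (e : Equiv.Perm (Fin n)) :
    MvPolynomial.rename e
      (∏ i : Fin n, ∏ j ∈ Finset.Ioi i,
        (MvPolynomial.X j - MvPolynomial.X i : MvPolynomial (Fin n) ℤ)) =
      ((Equiv.Perm.sign e : ℤ) : MvPolynomial (Fin n) ℤ) * ∏ i : Fin n, ∏ j ∈ Finset.Ioi i,
        (MvPolynomial.X j - MvPolynomial.X i : MvPolynomial (Fin n) ℤ) := by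
  rw [← Matrix.det_vandermonde, ← Matrix.det_permute, AlgHom.map_det]
  congr 1
  ext i j
  simp [Matrix.vandermonde]

/-- The sums `x_i + ⋯ + x_j` with `i < j`, without the sum of all variables. -/
def properSums (n : ℕ) : MvPolynomial (Fin (n + 2)) ℤ :=
  ∏ q ∈ ((Finset.univ : Finset (Fin (n + 2))).sigma fun i => Finset.Ioi i).erase
    ⟨0, Fin.last (n + 1)⟩, ∑ l ∈ Finset.Icc q.1 q.2, MvPolynomial.X l

lemma g_eq_vandermonde_mul (n : ℕ) :
    g (n + 2) = (∏ i : Fin (n + 2), ∏ j ∈ Finset.Ioi i, (MvPolynomial.X j - MvPolynomial.X i)) *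
      (∑ l, MvPolynomial.X l) * properSums n := by
  have h : (⟨0, Fin.last (n + 1)⟩ : Σ _ : Fin (n + 2), Fin (n + 2)) ∈
      (Finset.univ : Finset (Fin (n + 2))).sigma fun i => Finset.Ioi i := by
    simp
  have hI : Finset.Icc (0 : Fin (n + 2)) (Fin.last (n + 1)) = Finset.univ := by
    ext x
    simp [Fin.le_last]
  have h2 := Finset.mul_prod_erase _ (fun q : Σ _ : Fin (n + 2), Fin (n + 2) =>
    ∑ l ∈ Finset.Icc q.1 q.2, (MvPolynomial.X l : MvPolynomial (Fin (n + 2)) ℤ)) h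
  rw [hI, Finset.prod_sigma] at h2
  rw [g, properSums, mul_assoc, h2]
  simp only [Finset.prod_mul_distrib]

lemma totalDegree_properSums_lt (n : ℕ) :
    (properSums n).totalDegree < ∑ i ∈ Finset.range (n + 2), i := by
  have hcard : ((Finset.univ : Finset (Fin (n + 2))).sigma fun i => Finset.Ioi i).card =
      ∑ i ∈ Finset.range (n + 2), i := by
    rw [Finset.card_sigma, ← Finset.sum_range_reflect,
      ← Fin.sum_univ_eq_sum_range (fun i => n + 2 - 1 - i)]
    exact Finset.sum_congr rfl fun i _ => by rw [Fin.card_Ioi]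
  have hpos : 0 < ∑ i ∈ Finset.range (n + 2), i := by
    rw [Finset.sum_range_succ]
    omega
  have h : (properSums n).totalDegree ≤ ((Finset.univ.sigma fun i => Finset.Ioi i).erase
      (⟨0, Fin.last (n + 1)⟩ : Σ _ : Fin (n + 2), Fin (n + 2))).card := by
    refine (MvPolynomial.totalDegree_finsetProd _ _).trans ?_
    rw [Finset.card_eq_sum_ones]
    refine Finset.sum_le_sum fun q _ => MvPolynomial.totalDegree_finsetSum_le fun l _ => ?_
    rw [MvPolynomial.totalDegree_X]
  rw [Finset.card_erase_of_mem (by simp), hcard] at h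
  omega

/-- Setting aside the symmetric total sum leaves a cofactor of degree below that of the Vandermonde
product, so each of its monomials has two equal exponents. Swapping those variables negates the
product with the Vandermonde factor but fixes the target monomial, so the coefficient equals its
negative. -/
lemma coeff_constExp_g (n c : ℕ) : (g (n + 2)).coeff (constExp (n + 2) c) = 0 := by
  rw [g_eq_vandermonde_mul, (properSums n).as_sum, Finset.mul_sum, MvPolynomial.coeff_sum]
  refine Finset.sum_eq_zero fun β hβ => ?_
  obtain ⟨a, b, hab, hβab⟩ := exists_eq_of_degree_lt β
    ((MvPolynomial.le_totalDegree hβ).trans_lt (totalDegree_properSums_lt n))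
  have hβs : β.mapDomain (Equiv.swap a b) = β := by
    ext i
    rw [Finsupp.mapDomain_equiv_apply, Equiv.symm_swap]
    by_cases hia : i = a
    · rw [hia, Equiv.swap_apply_left, hβab]
    · by_cases hib : i = b
      · rw [hib, Equiv.swap_apply_right, hβab]
      · rw [Equiv.swap_apply_of_ne_of_ne hia hib]
  have hsum : MvPolynomial.rename (Equiv.swap a b)
      (∑ l, (MvPolynomial.X l : MvPolynomial (Fin (n + 2)) ℤ)) = ∑ l, MvPolynomial.X l := by
    rw [map_sum]
    exact Fintype.sum_equiv (Equiv.swap a b) _ _ fun l => by simp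
  have key := MvPolynomial.coeff_rename_mapDomain (Equiv.swap a b) (Equiv.swap a b).injective
    ((∏ i : Fin (n + 2), ∏ j ∈ Finset.Ioi i, (MvPolynomial.X j - MvPolynomial.X i)) *
      (∑ l, MvPolynomial.X l) * MvPolynomial.monomial β ((properSums n).coeff β))
    (constExp (n + 2) c)
  rw [constExp_mapDomain, map_mul, map_mul, rename_vandermonde, hsum,
    MvPolynomial.rename_monomial, hβs, Equiv.Perm.sign_swap hab] at key
  simp only [Units.val_neg, Units.val_one, Int.cast_neg, Int.cast_one, neg_mul, one_mul,
    MvPolynomial.coeff_neg] at key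
  omega

lemma eval_zero_coeffPolyG (n : ℕ) : (coeffPolyG (n + 2)).eval 0 = 0 := by
  have h := coeff_gMonomial_eq_eval (n + 2) 0 (by omega)
  rw [coeff_gMonomial _ _ (by omega), pow_zero, one_mul, coeff_constExp_g, Int.cast_zero,
    Nat.cast_zero] at h
  exact h.symm

end Antisymmetry

/-! ### From a nonzero coefficient to a sequence -/

section Nullstellensatz

lemma f_isHomogeneous (k : ℕ) : ∃ n, (f k).IsHomogeneous n := by
  refine ⟨_, MvPolynomial.IsHomogeneous.mul
    (MvPolynomial.IsHomogeneous.prod _ _ _ fun i _ => MvPolynomial.IsHomogeneous.prod _ _ _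
      fun j _ => (MvPolynomial.isHomogeneous_X ℤ j).sub (MvPolynomial.isHomogeneous_X ℤ i))
    (MvPolynomial.IsHomogeneous.prod _ _ _ fun i _ => MvPolynomial.IsHomogeneous.prod _ _ _
      fun j _ => MvPolynomial.IsHomogeneous.sum _ _ _
        fun l _ => MvPolynomial.isHomogeneous_X ℤ l)⟩

lemma HasSequence.mono {G : Type*} [AddCommGroup G] {A B : Finset G} {k : ℕ}
    (h : HasSequence A k) (hAB : A ⊆ B) : HasSequence B k := by
  obtain ⟨a, h1, h2, h3⟩ := h
  exact ⟨a, h1, fun i => hAB (h2 i), h3⟩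

lemma hasSequence_of_eval_ne_zero {R : Type*} [CommRing R] [IsDomain R] {A : Finset R}
    (h0 : (0 : R) ∉ A) {k : ℕ} (a : Fin k → R) (ha : ∀ i, a i ∈ A)
    (h : MvPolynomial.eval a (MvPolynomial.map (Int.castRingHom R) (f k)) ≠ 0) :
    HasSequence A k := by
  simp only [f, map_mul, map_prod, map_sub, map_sum, MvPolynomial.map_X, MvPolynomial.eval_X] at h
  have hdiff := left_ne_zero_of_mul h
  have hsum := right_ne_zero_of_mul h
  simp only [Finset.prod_ne_zero_iff, Finset.mem_Ioi, Finset.mem_univ, true_imp_iff,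
    Finset.mem_filter, true_and] at hdiff hsum
  have hinj : ∀ {b : Fin k → R}, (∀ i j, i < j → b i ≠ b j) → Function.Injective b := by
    intro b hb i j hij
    rcases lt_trichotomy i j with h | h | h
    · exact absurd hij (hb i j h)
    · exact h
    · exact absurd hij.symm (hb j i h)
  refine ⟨a, hinj fun i j hij => ?_, ha, hinj fun i j hij => ?_⟩
  · exact (sub_ne_zero.1 (hdiff i j hij)).symm
  · have hij' : (i : ℕ) < j := hij
    let i' : Fin k := ⟨i + 1, by omega⟩
    have hsplit : ∑ l ∈ Finset.Iic j, a l = ∑ l ∈ Finset.Iic i, a l + ∑ l ∈ Finset.Icc i' j, a l := by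
      rw [← Finset.sum_union]
      · congr 1
        ext l
        simp only [Finset.mem_Iic, Finset.mem_union, Finset.mem_Icc, Fin.le_def, i']
        omega
      · rw [Finset.disjoint_left]
        intro l
        simp only [Finset.mem_Iic, Finset.mem_Icc, Fin.le_def, i']
        omega
    -- Differences of partial sums never involve a_1, which is why f omits those sums; one-term
    -- differences are nonzero because 0 ∉ A.
    have hne : ∑ l ∈ Finset.Icc i' j, a l ≠ 0 := by
      rcases (show i' ≤ j from hij').eq_or_lt with h | h
      · rw [h, Finset.Icc_self, Finset.sum_singleton]
        exact fun h' => h0 (h' ▸ ha j)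
      · exact hsum i' (by simp [i']) j h
    intro heq
    rw [hsplit] at heq
    exact hne (by simpa using heq)

lemma hasSequence_of_coeff_ne_zero {R : Type*} [CommRing R] [IsDomain R] {A : Finset R}
    (h0 : (0 : R) ∉ A) {k : ℕ} (t : Fin k →₀ ℕ) (ht : ∀ i, t i < A.card)
    (hc : (((f k).coeff t : ℤ) : R) ≠ 0) : HasSequence A k := by
  obtain ⟨n, hn⟩ := f_isHomogeneous k
  have hc' : (MvPolynomial.map (Int.castRingHom R) (f k)).coeff t ≠ 0 := by
    rwa [MvPolynomial.coeff_map]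
  have hn' := hn.map (Int.castRingHom R)
  have hdeg : (MvPolynomial.map (Int.castRingHom R) (f k)).totalDegree = t.degree := by
    rw [hn'.totalDegree fun h => hc' (by rw [h, MvPolynomial.coeff_zero])]
    by_contra hne
    exact hc' (hn'.coeff_eq_zero (Ne.symm hne))
  obtain ⟨a, ha, hne⟩ := MvPolynomial.combinatorial_nullstellensatz_exists_eval_nonzero _ t hc' hdeg
    (fun _ => A) ht
  exact hasSequence_of_eval_ne_zero h0 a ha hne

end Nullstellensatz

/-! ### Admissible parameters and the polynomial α -/

section Parameters

lemma Admissible.le_add_one {d k : ℕ} (h : Admissible d k) : d ≤ k + 1 := by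
  by_contra! hlt
  have h1 : (k : ℝ) + 2 ≤ d := by exact_mod_cast hlt
  rcases min_lt_iff.1 h with h2 | h2
  · linarith
  -- (d - 4)² ≥ 0 says d²/8 ≥ d - 2.
  · nlinarith [sq_nonneg ((d : ℝ) - 4)]

lemma isGreatest_gMonomial {k d : ℕ} (hd : 3 < d) (hk : d ≤ k + 1) :
    IsGreatest (Set.range (gMonomial k d)) (2 * k + 1 - d) := by
  constructor
  · refine ⟨⟨k - 1, by omega⟩, ?_⟩
    simp only [gMonomial, Finsupp.coe_equivFunOnFinite_symm]
    rw [if_neg (by omega)]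
  · rintro _ ⟨i, rfl⟩
    simp only [gMonomial, Finsupp.coe_equivFunOnFinite_symm]
    split_ifs <;> omega

lemma isGreatest_fMonomial {k d : ℕ} (hd : 3 < d) (hk : d ≤ k) :
    IsGreatest (Set.range (fMonomial k d)) (2 * k - 1 - d) := by
  constructor
  · refine ⟨⟨k - 1, by omega⟩, ?_⟩
    simp only [fMonomial, Finsupp.coe_equivFunOnFinite_symm]
    rw [if_neg (by omega), if_neg (by omega)]
  · rintro _ ⟨i, rfl⟩
    simp only [fMonomial, Finsupp.coe_equivFunOnFinite_symm]
    split_ifs <;> omega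

/-- The polynomial giving the coefficients of `gMonomial k d` in `g k`. -/
def alpha (d : ℕ) : ℚ[X] := (coeffPolyG (d - 2)).comp (X - C ((d : ℚ) - 2))

lemma alpha_eval {d k : ℕ} (hd : 3 < d) (hk : d ≤ k + 2) :
    (((g k).coeff (gMonomial k d) : ℤ) : ℚ) = (alpha d).eval (k : ℚ) := by
  obtain ⟨n, rfl⟩ : ∃ n, d = n + 2 := ⟨d - 2, by omega⟩
  obtain ⟨r, rfl⟩ : ∃ r, k = n + r := ⟨k - n, by omega⟩
  rw [coeff_gMonomial_eq_eval n r (by omega), alpha, eval_comp]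
  simp

lemma alpha_ne_zero (d : ℕ) : alpha d ≠ 0 := by
  rw [alpha, Ne, comp_eq_zero_iff, not_or]
  refine ⟨coeffPolyG_ne_zero _, fun h => ?_⟩
  have := congrArg natDegree h.2
  rw [natDegree_X_sub_C, natDegree_C] at this
  exact one_ne_zero this

lemma natDegree_alpha {d : ℕ} (hd : 3 < d) : (alpha d).natDegree = bound d := by
  obtain ⟨n, rfl⟩ : ∃ n, d = n + 3 := ⟨d - 3, by omega⟩
  rw [alpha, natDegree_comp, natDegree_X_sub_C, mul_one, show n + 3 - 2 = n + 1 by omega,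
    natDegree_coeffPolyG, bound]
  rfl

lemma alpha_eval_sub_two {d : ℕ} (hd : 3 < d) : (alpha d).eval ((d : ℚ) - 2) = 0 := by
  obtain ⟨n, rfl⟩ : ∃ n, d = n + 4 := ⟨d - 4, by omega⟩
  rw [alpha, eval_comp, show n + 4 - 2 = n + 2 by omega]
  simpa using eval_zero_coeffPolyG n

lemma coeff_fMonomial_eq_eval {d k : ℕ} (hd : 3 < d) (hk : d ≤ k + 1) :
    (((f k).coeff (fMonomial k d) : ℤ) : ℚ) = (-1) ^ (k - 1) * (alpha d).eval ((k : ℚ) - 1) := by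
  obtain ⟨m, rfl⟩ : ∃ m, k = m + 1 := ⟨k - 1, by omega⟩
  rw [coeff_fMonomial, Int.cast_mul, alpha_eval hd (by omega)]
  simp

lemma encard_le_natDegree {R : Type*} [CommRing R] [IsDomain R] {q : R[X]} (hq : q ≠ 0) {ι : Type*}
    (S : Set ι) (φ : ι → R) (hφ : Set.InjOn φ S) (h : ∀ k ∈ S, q.eval (φ k) = 0) :
    S.encard ≤ q.natDegree := by
  classical
  rw [← hφ.encard_image]
  have hsub : φ '' S ⊆ (q.roots.toFinset : Set R) := by
    rintro _ ⟨k, hk, rfl⟩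
    simpa [hq] using h k hk
  refine (Set.encard_le_encard hsub).trans ?_
  rw [Set.encard_coe_eq_coe_finsetCard, Nat.cast_le]
  exact (Multiset.toFinset_card_le _).trans (card_roots' q)

lemma exists_int_multiple (q : ℚ[X]) (hq : q ≠ 0) : ∃ (b : ℤ) (γ : ℤ[X]), b ≠ 0 ∧ γ ≠ 0 ∧
    γ.natDegree ≤ q.natDegree ∧ ∀ x : ℤ, ((γ.eval x : ℤ) : ℚ) = b * q.eval (x : ℚ) := by
  obtain ⟨b, hb, h⟩ := IsLocalization.integerNormalization_spec (nonZeroDivisors ℤ) q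
  have hb0 : b ≠ 0 := nonZeroDivisors.ne_zero hb
  refine ⟨b, _, hb0, IsFractionRing.integerNormalization_eq_zero_iff.not.2 hq, ?_, fun x => ?_⟩
  · exact natDegree_le_natDegree
      (degree_mono (IsLocalization.integerNormalization_support (nonZeroDivisors ℤ) q))
  · have h1 := congrArg (eval (x : ℚ)) h
    rw [eval_smul, zsmul_eq_mul, eval_map, ← eq_intCast (algebraMap ℤ ℚ) x, eval₂_at_apply] at h1
    simpa using h1

end Parameters

/-! ### Root counting modulo p -/

section Primes

/-- If `γ` is an integer multiple of `alpha d` and `γ (k - 1)` is nonzero modulo `p`, then every set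
of at least `2 k - d` nonzero residues contains a sequence of the required kind. -/
lemma hasSequence_of_eval_intMultiple_ne_zero {d k p : ℕ} [Fact p.Prime] (hd : 3 < d)
    (hk : d ≤ k + 1) {b : ℤ} {γ : ℤ[X]}
    (hγ : ∀ x : ℤ, ((γ.eval x : ℤ) : ℚ) = b * (alpha d).eval (x : ℚ))
    (hne : ((γ.eval ((k : ℤ) - 1) : ℤ) : ZMod p) ≠ 0) (A : Finset (ZMod p)) (h0 : 0 ∉ A)
    (hA : 2 * k ≤ A.card + d) : HasSequence A k := by
  have hk' : d ≤ k := by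
    by_contra! hlt
    -- At k = d - 1 the value is α(d - 2) = 0, contradicting `hne`.
    obtain rfl : d = k + 1 := by omega
    apply hne
    have h1 := hγ ((k : ℤ) - 1)
    have h2 := alpha_eval_sub_two hd
    rw [show (((k : ℤ) - 1 : ℤ) : ℚ) = ((k + 1 : ℕ) : ℚ) - 2 by push_cast; ring, h2, mul_zero] at h1
    rw [Int.cast_eq_zero.1 h1, Int.cast_zero]
  have hcoeff : (-1) ^ (k - 1) * γ.eval ((k : ℤ) - 1) = b * (f k).coeff (fMonomial k d) := by
    rw [← Int.cast_inj (α := ℚ)]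
    push_cast
    rw [hγ, coeff_fMonomial_eq_eval hd hk]
    push_cast
    ring
  refine hasSequence_of_coeff_ne_zero h0 (fMonomial k d) (fun i => ?_) fun h => ?_
  · have := (isGreatest_fMonomial hd hk').2 ⟨i, rfl⟩
    omega
  · have := congrArg (Int.cast : ℤ → ZMod p) hcoeff
    rw [Int.cast_mul, Int.cast_mul, h, mul_zero] at this
    rcases mul_eq_zero.1 this with h' | h'
    · push_cast at h'
      exact pow_ne_zero _ (neg_ne_zero.2 one_ne_zero) h'
    · exact hne h'

lemma exists_exceptional_set {p : ℕ} [Fact p.Prime] {γ : ℤ[X]} (hγ : γ ≠ 0)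
    (hp : γ.leadingCoeff.natAbs < p) : ∃ E : Finset ℕ, E.card ≤ γ.natDegree ∧
      ∀ k : ℕ, 1 ≤ k → k ≤ p → k ∉ E → ((γ.eval ((k : ℤ) - 1) : ℤ) : ZMod p) ≠ 0 := by
  classical
  have hlead : (Int.castRingHom (ZMod p)) γ.leadingCoeff ≠ 0 := by
    intro h
    rw [eq_intCast, ZMod.intCast_zmod_eq_zero_iff_dvd] at h
    have h1 := Int.natAbs_dvd_natAbs.2 h
    rw [Int.natAbs_natCast] at h1
    have h2 := Nat.le_of_dvd (Int.natAbs_pos.2 (leadingCoeff_ne_zero.2 hγ)) h1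
    omega
  have heval : ∀ k : ℕ, (γ.map (Int.castRingHom (ZMod p))).eval ((k : ZMod p) - 1) =
      ((γ.eval ((k : ℤ) - 1) : ℤ) : ZMod p) := by
    intro k
    have := eval_intCast_map (Int.castRingHom (ZMod p)) γ ((k : ℤ) - 1)
    simpa using this
  have hmap : γ.map (Int.castRingHom (ZMod p)) ≠ 0 := fun h => hlead (by
    rw [leadingCoeff, ← coeff_map, h, coeff_zero])
  -- On 1 ≤ k ≤ p the residues k - 1 are distinct, so bad k inject into the roots of γ modulo p.
  refine ⟨(Finset.Icc 1 p).filter fun k => ((γ.eval ((k : ℤ) - 1) : ℤ) : ZMod p) = 0, ?_, ?_⟩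
  · have h := encard_le_natDegree hmap
      (((Finset.Icc 1 p).filter fun k => ((γ.eval ((k : ℤ) - 1) : ℤ) : ZMod p) = 0 :
        Finset ℕ) : Set ℕ) (fun k => (k : ZMod p) - 1) ?_ ?_
    · rw [Set.encard_coe_eq_coe_finsetCard, Nat.cast_le] at h
      exact h.trans natDegree_map_le
    · intro x hx y hy hxy
      have hx := Finset.mem_Icc.1 (Finset.mem_filter.1 (Finset.mem_coe.1 hx)).1
      have hy := Finset.mem_Icc.1 (Finset.mem_filter.1 (Finset.mem_coe.1 hy)).1
      obtain ⟨x, rfl⟩ := Nat.exists_eq_add_of_le' hx.1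
      obtain ⟨y, rfl⟩ := Nat.exists_eq_add_of_le' hy.1
      have hxy' : (x : ZMod p) = y := by simpa using hxy
      rw [ZMod.natCast_eq_natCast_iff] at hxy'
      rw [Nat.ModEq.eq_of_lt_of_lt hxy' (by omega) (by omega)]
    · intro k hk
      rw [heval]
      exact (Finset.mem_filter.1 (Finset.mem_coe.1 hk)).2
  · intro k h1 h2 hE h
    exact hE (Finset.mem_filter.2 ⟨Finset.mem_Icc.2 ⟨h1, h2⟩, h⟩)

lemma card_lt_of_zero_notMem {p : ℕ} [Fact p.Prime] {A : Finset (ZMod p)} (h0 : 0 ∉ A) :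
    A.card < p := by
  have := Finset.card_lt_univ_of_notMem h0
  rwa [ZMod.card] at this

end Primes

end PartialSums

end

theorem theorem5 (d : ℕ) (hd : 3 < d) :
    -- the coefficients of the two monomials are given by one polynomial `α` of the stated degree
    (∃ α : ℚ[X], α ≠ 0 ∧ α.natDegree = PartialSums.bound d ∧
      ∀ k : ℕ, PartialSums.Admissible d k →
        (((PartialSums.g k).coeff (PartialSums.gMonomial k d) : ℤ) : ℚ) = α.eval (k : ℚ) ∧
        (((PartialSums.f k).coeff (PartialSums.fMonomial k d) : ℤ) : ℚ)
          = (-1) ^ (k - 1) * α.eval ((k : ℚ) - 1)) ∧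
    -- all but at most `bound d` values of `k` give a nonzero coefficient in `g_k`
    {k : ℕ | PartialSums.Admissible d k ∧
      ¬ ((PartialSums.g k).coeff (PartialSums.gMonomial k d) ≠ 0 ∧
        IsGreatest (Set.range (PartialSums.gMonomial k d)) (2 * k + 1 - d))}.encard
      ≤ PartialSums.bound d ∧
    -- all but at most `bound d` values of `k` give a nonzero coefficient in `f_k`
    {k : ℕ | PartialSums.Admissible d k ∧
      ¬ ((PartialSums.f k).coeff (PartialSums.fMonomial k d) ≠ 0 ∧
        IsGreatest (Set.range (PartialSums.fMonomial k d)) (2 * k - 1 - d))}.encard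
      ≤ PartialSums.bound d ∧
    -- for all but finitely many primes `p`, all but at most `bound d` values of `k` are good
    {p : ℕ | p.Prime ∧
      ¬ ∃ E : Finset ℕ, E.card ≤ PartialSums.bound d ∧
        ∀ k : ℕ, PartialSums.Admissible d k → k ∉ E →
          (∀ A : Finset (ZMod p), 0 ∉ A → A.card + d = 2 * k → PartialSums.HasSequence A k) ∧
          (⌊√(8 * (k : ℝ))⌋₊ = d →
            ∀ A : Finset (ZMod p), 0 ∉ A → 2 * (k : ℝ) - √(8 * (k : ℝ)) ≤ (A.card : ℝ) →
              PartialSums.HasSequence A k)}.Finite := by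
  have hα := PartialSums.alpha_ne_zero d
  have hdeg := PartialSums.natDegree_alpha hd
  refine ⟨⟨PartialSums.alpha d, hα, hdeg, fun k hk => ?_⟩, ?_, ?_, ?_⟩
  · have hk' := hk.le_add_one
    exact ⟨PartialSums.alpha_eval hd (by omega), PartialSums.coeff_fMonomial_eq_eval hd hk'⟩
  · rw [← hdeg]
    refine PartialSums.encard_le_natDegree hα _ (fun k : ℕ => (k : ℚ))
      Nat.cast_injective.injOn ?_
    rintro k ⟨hk, hbad⟩
    have hk' := hk.le_add_one
    rw [← PartialSums.alpha_eval hd (by omega), Int.cast_eq_zero]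
    by_contra h
    exact hbad ⟨h, PartialSums.isGreatest_gMonomial hd hk'⟩
  · rw [← hdeg]
    refine PartialSums.encard_le_natDegree hα _ (fun k : ℕ => (k : ℚ) - 1)
      (fun x _ y _ h => by simpa using h) ?_
    rintro k ⟨hk, hbad⟩
    have hk' := hk.le_add_one
    rcases hk'.eq_or_lt with rfl | hlt
    · rw [← PartialSums.alpha_eval_sub_two hd]
      congr 1
      push_cast
      ring
    · by_contra h
      refine hbad ⟨fun h0 => h ?_, PartialSums.isGreatest_fMonomial hd (by omega)⟩
      have h1 := PartialSums.coeff_fMonomial_eq_eval hd hk'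
      rw [h0, Int.cast_zero, zero_eq_mul] at h1
      exact h1.resolve_left (pow_ne_zero _ (by norm_num))
  · obtain ⟨b, γ, -, hγ, hγdeg, hγeval⟩ := PartialSums.exists_int_multiple _ hα
    -- p beyond the leading coefficient keeps γ nonzero modulo p; p > d with |A| < p and 2k = |A| +
    -- d forces k ≤ p.
    refine (Set.finite_Iic (max d γ.leadingCoeff.natAbs)).subset ?_
    rintro p ⟨hp, hbad⟩
    by_contra hlarge
    rw [Set.mem_Iic, not_le, max_lt_iff] at hlarge
    have : Fact p.Prime := ⟨hp⟩
    obtain ⟨E, hE, hEk⟩ := PartialSums.exists_exceptional_set hγ hlarge.2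
    refine hbad ⟨E, hE.trans (hγdeg.trans hdeg.le), fun k hk hkE => ?_⟩
    have hk' := hk.le_add_one
    have main : ∀ A : Finset (ZMod p), 0 ∉ A → A.card + d = 2 * k →
        PartialSums.HasSequence A k := by
      intro A h0 hA
      have hAp := PartialSums.card_lt_of_zero_notMem h0
      exact PartialSums.hasSequence_of_eval_intMultiple_ne_zero hd hk' hγeval
        (hEk k (by omega) (by omega) hkE) A h0 hA.ge
    refine ⟨main, fun hfloor A h0 hA => ?_⟩
    have h1 : √(8 * (k : ℝ)) < d + 1 := by
      rw [← hfloor]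
      exact Nat.lt_floor_add_one _
    have h2 : 2 * k < A.card + d + 1 := by
      have : (2 * k : ℝ) < A.card + d + 1 := by linarith
      exact_mod_cast this
    obtain ⟨B, hBA, hB⟩ := Finset.exists_subset_card_eq (show 2 * k - d ≤ A.card by omega)
    exact (main B (fun h => h0 (hBA h)) (by omega)).mono hBA
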